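/- Let $\mathcal S_n$ be the set of permutations of $\{1,\dots,n\}$ and $\mathcal S=\bigcup_{n\ge 0}\mathcal S_n$; write $|\pi|=n$ for $\pi\in\mathcal S_n$. For $\pi\in\mathcal S_n$ let $c_{\underline{123}}(\pi)$ be the number of $i$ with $1\le i\le n-2$ and $\pi(i)<\pi(i+1)<\pi(i+2)$, let $\mathrm{asc}(\pi)$ be the number of $i$ with $1\le i\le n-1$ and $\pi(i)<\pi(i+1)$, and let $\mathrm{lrmin}(\pi)$ be the number of $i$ with $\pi(i)<\pi(j)$ for all $j<i$. Let $\mathrm{exc}(\pi)$ be the number of values $\pi(i)$ with $i<\pi(i)$ (excedances), $\mathrm{dexc}(\pi)$ the number of values $\pi(i)$ with $i<\pi(i)<\pi(\pi(i))$ (double excedances), and $\mathrm{cyc}(\pi)$ the number of cycles of $\pi$, fixed points included. Let $\hat\pi$ be the permutation whose one-line notation is obtained by writing each cycle of $\pi$ with its smallest element first, ordering the cycles by decreasing smallest element, and removing the parentheses. For sequences $d=(d_1,d_2,\dots)$ and $\ell=(\ell_0,\ell_1,\dots)$ in a commutative ring, let $$J_{d,\ell}(z)=\cfrac{1}{1-\ell_0z-\cfrac{d_1z^2}{1-\ell_1z-\cfrac{d_2z^2}{1-\ell_2z-\cdots}}}$$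 be the formal power series that is the coefficientwise limit of the finite truncations of this continued fraction. Then, for all elements $v,w,t$ of a commutative ring (in particular for indeterminates), the following hold. 1. $\displaystyle\sum_{\pi\in\mathcal S} w^{c_{\underline{123}}(\pi)}z^{|\pi|}=J_{d,\ell}(z)$ with $d_h=h^2$ and $\ell_h=(h+1)+hw$. 2. $\displaystyle\sum_{\pi\in\mathcal S} v^{\mathrm{asc}(\pi)}w^{c_{\underline{123}}(\pi)}t^{\mathrm{lrmin}(\pi)}z^{|\pi|}=J_{d,\ell}(z)$ with $d_h=vh(h-1+t)$ and $\ell_h=t+h(1+vw)$. 3. For every $n\ge 0$, the map $\pi\mapsto\hat\pi$ is a bijection from $\mathcal S_n$ to itself, and for every $\pi\in\mathcal S_n$: - $c_{\underline{123}}(\hat\pi)=\mathrm{dexc}(\pi)$; more precisely, the triples $(\hat\pi(i),\hat\pi(i+1),\hat\pi(i+2))$ with $\hat\pi(i)<\hat\pi(i+1)<\hat\pi(i+2)$ are exactly the triples $(a,\pi(a),\pi(\pi(a)))$ with $a<\pi(a)<\pi(\pi(a))$; - $\mathrm{asc}(\hat\pi)=\mathrm{exc}(\pi)$; more precisely, the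 pairs $(\hat\pi(i),\hat\pi(i+1))$ with $\hat\pi(i)<\hat\pi(i+1)$ are exactly the pairs $(a,\pi(a))$ with $a<\pi(a)$; - $\mathrm{lrmin}(\hat\pi)=\mathrm{cyc}(\pi)$; more precisely, $\hat\pi(i)$ is a left-to-right minimum of $\hat\pi$ if and only if it is the smallest element of its cycle in $\pi$. -/

import Mathlib

namespace PermStat

open Equiv

variable {n : ℕ}

/-! Permutations of `{1, …, n}` are modelled as `Perm (Fin n)` (all entries shifted by one). -/

/-- Positions `i` at which an occurrence `π(i) < π(i+1) < π(i+2)` of the consecutive pattern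
`123` starts. -/
def occ123 (π : Perm (Fin n)) : Finset (Fin n) :=
  Finset.univ.filter fun i =>
    ∃ j k : Fin n, (j : ℕ) = i + 1 ∧ (k : ℕ) = i + 2 ∧ π i < π j ∧ π j < π k

/-- Ascent positions: `i` with `π(i) < π(i+1)`. -/
def ascents (π : Perm (Fin n)) : Finset (Fin n) :=
  Finset.univ.filter fun i => ∃ j : Fin n, (j : ℕ) = i + 1 ∧ π i < π j

/-- Positions of left-to-right minima: `i` with `π(i) < π(j)` for all `j < i`. -/
def lrMinima (π : Perm (Fin n)) : Finset (Fin n) :=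
  Finset.univ.filter fun i => ∀ j : Fin n, j < i → π i < π j

/-- The excedance values: values `π(i)` with `i < π(i)`. -/
def excedances (π : Perm (Fin n)) : Finset (Fin n) :=
  (Finset.univ.filter fun i => i < π i).image π

/-- The double excedance values: values `π(i)` with `i < π(i) < π(π(i))`. -/
def doubleExcedances (π : Perm (Fin n)) : Finset (Fin n) :=
  (Finset.univ.filter fun i => i < π i ∧ π i < π (π i)).image π

/-- Number of cycles of `π`, fixed points included. -/
noncomputable def cycleCount (π : Perm (Fin n)) : ℕ :=
  Nat.card (Quotient (Perm.SameCycle.setoid π))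

/-- `m` is the smallest element of its cycle. -/
def IsCycleMin (π : Perm (Fin n)) (m : Fin n) : Prop :=
  ∀ j : Fin n, π.SameCycle m j → m ≤ j

instance (π : Perm (Fin n)) : DecidablePred (IsCycleMin π) := fun m =>
  inferInstanceAs (Decidable (∀ j : Fin n, π.SameCycle m j → m ≤ j))

/-- The cycle of `π` through `m`, written starting at `m`: `m, π(m), π(π(m)), …`. -/
def cycleWord (π : Perm (Fin n)) (m : Fin n) : List (Fin n) :=
  List.iterate π m (Finset.univ.filter fun j => π.SameCycle m j).card

/-- The smallest elements of the cycles of `π`, in decreasing order. -/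
def cycleMinima (π : Perm (Fin n)) : List (Fin n) :=
  ((List.finRange n).filter fun m => IsCycleMin π m).reverse

/-- The cycles of `π`, each written with its smallest element first, sorted by decreasing
smallest element, and concatenated (parentheses removed). -/
def foataWord (π : Perm (Fin n)) : List (Fin n) :=
  (cycleMinima π).flatMap (cycleWord π)

theorem sameCycle_iff_iterate (π : Perm (Fin n)) (m j : Fin n) :
    π.SameCycle m j ↔ ∃ k < Function.minimalPeriod π m, j = π^[k] m := by
  constructor
  · intro h
    obtain ⟨k, -, hk⟩ := h.exists_pow_eq'
    refine ⟨k % Function.minimalPeriod π m, Nat.mod_lt _ ?_, ?_⟩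
    · exact Function.minimalPeriod_pos_of_mem_periodicPts
        (π.injective.mem_periodicPts m)
    · rw [Function.iterate_mod_minimalPeriod_eq, ← hk, Perm.iterate_eq_pow]
  · rintro ⟨k, -, rfl⟩
    rw [Perm.iterate_eq_pow]
    exact ⟨k, by simp⟩

theorem card_sameCycle (π : Perm (Fin n)) (m : Fin n) :
    (Finset.univ.filter fun j => π.SameCycle m j).card = Function.minimalPeriod π m := by
  have h : (Finset.univ.filter fun j => π.SameCycle m j) =
      (Finset.range (Function.minimalPeriod π m)).image fun k => π^[k] m := by
    ext j
    simp only [Finset.mem_filter, Finset.mem_univ, true_and, sameCycle_iff_iterate,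
      Finset.mem_image, Finset.mem_range, eq_comm]
  rw [h, Finset.card_image_of_injOn, Finset.card_range]
  simpa using Function.iterate_injOn_Iio_minimalPeriod (f := π) (x := m)

theorem nodup_cycleWord (π : Perm (Fin n)) (m : Fin n) : (cycleWord π m).Nodup := by
  rw [cycleWord, card_sameCycle, ← List.range_map_iterate]
  refine List.Nodup.map_on ?_ List.nodup_range
  intro a ha b hb hab
  exact Function.iterate_injOn_Iio_minimalPeriod (List.mem_range.1 ha) (List.mem_range.1 hb) hab

theorem mem_cycleWord (π : Perm (Fin n)) (m j : Fin n) :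
    j ∈ cycleWord π m ↔ π.SameCycle m j := by
  rw [cycleWord, card_sameCycle, List.mem_iterate, sameCycle_iff_iterate]

theorem mem_cycleMinima (π : Perm (Fin n)) (m : Fin n) :
    m ∈ cycleMinima π ↔ IsCycleMin π m := by
  simp [cycleMinima]

theorem nodup_foataWord (π : Perm (Fin n)) : (foataWord π).Nodup := by
  rw [foataWord, List.nodup_flatMap]
  refine ⟨fun m _ => nodup_cycleWord π m, ?_⟩
  have hnd : (cycleMinima π).Nodup :=
    List.nodup_reverse.2 ((List.nodup_finRange n).filter _)
  refine List.Pairwise.imp_of_mem ?_ hnd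
  intro a b ha hb hab j hja hjb
  rw [mem_cycleMinima] at ha hb
  rw [mem_cycleWord] at hja hjb
  exact hab (le_antisymm (ha b (hja.trans hjb.symm)) (hb a (hjb.trans hja.symm)))

theorem mem_foataWord (π : Perm (Fin n)) (j : Fin n) : j ∈ foataWord π := by
  obtain ⟨m, hm, hmin⟩ := Finset.exists_min_image
    (Finset.univ.filter fun i => π.SameCycle j i) id ⟨j, by simp [Perm.SameCycle.refl]⟩
  simp only [Finset.mem_filter, Finset.mem_univ, true_and, id] at hm hmin
  refine List.mem_flatMap.2 ⟨m, (mem_cycleMinima π m).2 fun i hi => hmin i (hm.trans hi), ?_⟩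
  exact (mem_cycleWord π m j).2 hm.symm

theorem length_foataWord (π : Perm (Fin n)) : (foataWord π).length = n := by
  rw [← List.toFinset_card_of_nodup (nodup_foataWord π),
    Finset.eq_univ_iff_forall.2 fun j => List.mem_toFinset.2 (mem_foataWord π j),
    Finset.card_univ, Fintype.card_fin]

/-- The permutation `π̂` whose one-line notation `π̂(1) π̂(2) … π̂(n)` is `foataWord π`. -/
def foataHat (π : Perm (Fin n)) : Perm (Fin n) :=
  (finCongr (length_foataWord π).symm).trans
    ((nodup_foataWord π).getEquivOfForallMemList _ (mem_foataWord π))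

end PermStat

namespace JFrac

open PowerSeries

variable {R : Type*} [CommRing R]

/-- The finite continued fraction of depth `N` starting at level `h`,
`1 / (1 - ℓ_h z - d_{h+1} z² / (1 - ℓ_{h+1} z - ⋯ d_{h+N} z² / (1 - ℓ_{h+N} z)))`,
as a formal power series (every denominator has constant coefficient `1`, so that
`invOfUnit _ 1` is its inverse). -/
noncomputable def convergentFrom (d l : ℕ → R) : ℕ → ℕ → R⟦X⟧
  | h, 0 => invOfUnit (1 - C (l h) * X) 1
  | h, N + 1 => invOfUnit
      (1 - C (l h) * X - C (d (h + 1)) * X ^ 2 * convergentFrom d l (h + 1) N) 1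

/-- `F` is the J-fraction with coefficients `d = (d₁, d₂, …)` and `ℓ = (ℓ₀, ℓ₁, …)`: its
convergents converge to `F` as formal power series, i.e. each coefficient is eventually
that of `F`. The value `d 0` plays no role. -/
def IsJFraction (F : R⟦X⟧) (d l : ℕ → R) : Prop :=
  ∀ n : ℕ, ∀ᶠ N in Filter.atTop, coeff n (convergentFrom d l 0 N) = coeff n F

end JFrac

/-! ### The word of the cycles: ascents, records and bijectivity -/

namespace PermStat

open Equiv

variable {n : ℕ}

/-! In the word of `π̂`, a letter `a` is followed by `π a`, unless `a` ends its cycle. In that case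
`π a` is the minimum of the cycle, so `a` is not below its image, and the next letter is a new cycle
minimum, smaller than everything before it. Hence ascents of `π̂` are excedances of `π`, consecutive
ascents are double excedances, and records are cycle minima. The records cut the word back into
cycles, so the map is injective.

It remains to count permutations by excedances, double excedances and cycles. Each element gets a
weight in `R[X]`, depending on its comparisons with its preimage and its image; at `X = 0` the
product of the weights gives the wanted statistics. Inserting a new maximum before `x` in its cycle
alters the type of exactly one old element, and the weights are chosen so that summing over `x`
differentiates the product (`sum_weight_insertLast_some`). With `q = v + (1 + vw) X + X²` this gives
`P (n+1) = t (1 + X) P n + q (P n)'`. On coefficients this is a tridiagonal recurrence, and the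
constant terms then have a J-fraction as generating function (`isJFraction_of_recurrence`). -/

theorem IsCycleMin.eq_of_sameCycle {π : Perm (Fin n)} {a b : Fin n} (ha : IsCycleMin π a)
    (hb : IsCycleMin π b) (h : π.SameCycle a b) : a = b :=
  le_antisymm (ha b h) (hb a h.symm)

theorem exists_isCycleMin_sameCycle (π : Perm (Fin n)) (a : Fin n) :
    ∃ m, IsCycleMin π m ∧ π.SameCycle m a := by
  obtain ⟨m, hm, h⟩ := List.mem_flatMap.1 (mem_foataWord π a)
  exact ⟨m, (mem_cycleMinima π m).1 hm, (mem_cycleWord π m a).1 h⟩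

theorem IsCycleMin.apply_le {π : Perm (Fin n)} {a : Fin n} (h : IsCycleMin π (π a)) :
    π a ≤ a :=
  h a (Perm.sameCycle_apply_left.2 (Perm.SameCycle.refl π a))

theorem length_cycleWord (π : Perm (Fin n)) (m : Fin n) :
    (cycleWord π m).length = Function.minimalPeriod π m := by
  rw [cycleWord, card_sameCycle, List.length_iterate]

theorem getElem_cycleWord (π : Perm (Fin n)) (m : Fin n) (i : ℕ)
    (h : i < (cycleWord π m).length) : (cycleWord π m)[i] = π^[i] m :=
  List.getElem_iterate ..

theorem minimalPeriod_pos (π : Perm (Fin n)) (m : Fin n) : 0 < Function.minimalPeriod π m :=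
  Function.minimalPeriod_pos_of_mem_periodicPts (π.injective.mem_periodicPts m)

theorem cycleWord_eq_cons (π : Perm (Fin n)) (m : Fin n) :
    ∃ l, cycleWord π m = m :: l := by
  obtain ⟨k, hk⟩ := Nat.exists_eq_succ_of_ne_zero (minimalPeriod_pos π m).ne'
  exact ⟨_, by rw [cycleWord, card_sameCycle, hk, List.iterate]⟩

theorem isChain_cycleWord (π : Perm (Fin n)) (m : Fin n) :
    (cycleWord π m).IsChain fun a b => b = π a := by
  rw [List.isChain_iff_getElem]
  intro i hi
  rw [getElem_cycleWord, getElem_cycleWord, Function.iterate_succ_apply']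

theorem apply_getLast_cycleWord (π : Perm (Fin n)) (m a : Fin n)
    (h : a ∈ (cycleWord π m).getLast?) : π a = m := by
  have hpos := minimalPeriod_pos π m
  rw [List.getLast?_eq_getElem?, Option.mem_def, List.getElem?_eq_some_iff] at h
  obtain ⟨hi, rfl⟩ := h
  rw [getElem_cycleWord, length_cycleWord, ← Function.iterate_succ_apply' π]
  have : (Function.minimalPeriod π m - 1).succ = Function.minimalPeriod π m := by lia
  rw [this, Function.iterate_minimalPeriod]

/-- Applying `π` to the end of a cycle word returns to its minimum, and the next word starts with a
minimum. The clause on the last letter is needed later for excedances, which must have a successor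
in the word. -/
theorem isChain_flatMap_cycleWord (π : Perm (Fin n)) (L : List (Fin n))
    (hL : ∀ m ∈ L, IsCycleMin π m) :
    (L.flatMap (cycleWord π)).IsChain
        (fun a b => b = π a ∨ (IsCycleMin π b ∧ IsCycleMin π (π a))) ∧
      ∀ a ∈ (L.flatMap (cycleWord π)).getLast?, IsCycleMin π (π a) := by
  induction L with
  | nil => simp
  | cons m L ih =>
    obtain ⟨ih₁, ih₂⟩ := ih fun x hx => hL x (List.mem_cons_of_mem _ hx)
    have hlast : ∀ a ∈ (cycleWord π m).getLast?, IsCycleMin π (π a) := by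
      intro a ha
      rw [apply_getLast_cycleWord π m a ha]
      exact hL m List.mem_cons_self
    rw [List.flatMap_cons]
    refine ⟨?_, ?_⟩
    · refine ((isChain_cycleWord π m).imp fun a b h => Or.inl h).append ih₁ ?_
      intro a ha b hb
      refine Or.inr ⟨?_, hlast a ha⟩
      cases L with
      | nil => simp at hb
      | cons m' L =>
        obtain ⟨l, hl⟩ := cycleWord_eq_cons π m'
        rw [List.flatMap_cons, hl] at hb
        simp only [List.cons_append, List.head?_cons, Option.mem_def, Option.some.injEq] at hb
        exact hb ▸ hL m' (by simp)
    · intro a ha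
      rw [List.getLast?_append, Option.mem_def, Option.or_eq_some_iff] at ha
      rcases ha with h | h
      · exact ih₂ a h
      · exact hlast a h.2

/-- A cycle minimum is the first letter of its cycle word, hence preceded only by letters of cycles
with larger minima. -/
theorem pairwise_foataWord (π : Perm (Fin n)) :
    (foataWord π).Pairwise fun a b => IsCycleMin π b → b < a ∧ ¬π.SameCycle a b := by
  rw [foataWord, List.pairwise_flatMap]
  refine ⟨fun m hm => ?_, ?_⟩
  · obtain ⟨l, hl⟩ := cycleWord_eq_cons π m
    have hnd := nodup_cycleWord π m
    have hmem := mem_cycleWord π m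
    rw [mem_cycleMinima] at hm
    rw [List.pairwise_iff_getElem]
    intro i j hi hj hij hmin
    have hj' := hm.eq_of_sameCycle hmin ((hmem _).1 (List.getElem_mem hj))
    have h0 : (cycleWord π m)[0]'(by lia) = m := by simp [hl]
    have := hnd.getElem_inj_iff.1 (h0.trans hj')
    lia
  · have hs : (cycleMinima π).Pairwise (· > ·) := by
      rw [cycleMinima, List.pairwise_reverse]
      exact (List.pairwise_lt_finRange n).filter _
    refine hs.imp_of_mem fun {a b} ha hb hab x hx y hy hmin => ?_
    rw [mem_cycleMinima] at ha hb
    rw [mem_cycleWord] at hx hy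
    obtain rfl := hb.eq_of_sameCycle hmin hy
    refine ⟨hab.trans_le (ha x hx), fun h => ?_⟩
    exact hab.ne' (ha.eq_of_sameCycle hb (hx.trans h))

theorem foataHat_apply (π : Perm (Fin n)) (i : Fin n) :
    foataHat π i = (foataWord π)[(i : ℕ)]'((length_foataWord π).symm ▸ i.2) := rfl

theorem foataHat_succ (π : Perm (Fin n)) {i j : Fin n} (h : (j : ℕ) = i + 1) :
    foataHat π j = π (foataHat π i) ∨
      (IsCycleMin π (foataHat π j) ∧ IsCycleMin π (π (foataHat π i))) := by
  have hc := (isChain_flatMap_cycleWord π (cycleMinima π)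
    fun m hm => (mem_cycleMinima π m).1 hm).1
  rw [List.isChain_iff_getElem] at hc
  have := hc i (by have := length_foataWord π; have := j.2; rw [foataWord] at *; lia)
  simp only [foataHat_apply, h]
  exact this

theorem isCycleMin_apply_foataHat_last (π : Perm (Fin n)) {i : Fin n} (h : (i : ℕ) + 1 = n) :
    IsCycleMin π (π (foataHat π i)) := by
  refine (isChain_flatMap_cycleWord π (cycleMinima π)
    fun m hm => (mem_cycleMinima π m).1 hm).2 _ ?_
  change _ ∈ (foataWord π).getLast?
  rw [List.getLast?_eq_getElem?, Option.mem_def, List.getElem?_eq_some_iff]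
  have hl := length_foataWord π
  exact ⟨by lia, by simp only [foataHat_apply, hl]; congr 1; lia⟩

theorem IsCycleMin.lt_foataHat {π : Perm (Fin n)} {i j : Fin n} (hij : i < j)
    (h : IsCycleMin π (foataHat π j)) :
    foataHat π j < foataHat π i ∧ ¬π.SameCycle (foataHat π i) (foataHat π j) :=
  List.pairwise_iff_getElem.1 (pairwise_foataWord π) i j _ _ hij h

/-- Left-to-right minima of `π̂` are the cycle minima of `π`. -/
theorem mem_lrMinima_foataHat (π : Perm (Fin n)) (i : Fin n) :
    i ∈ lrMinima (foataHat π) ↔ IsCycleMin π (foataHat π i) := by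
  simp only [lrMinima, Finset.mem_filter, Finset.mem_univ, true_and]
  refine ⟨fun h => ?_, fun h j hj => (h.lt_foataHat hj).1⟩
  -- The minimum `m` of the cycle of the record stands somewhere in the word. Earlier, it would
  -- contradict the record; later, it would be a cycle minimum preceded by a letter of its own
  -- cycle.
  obtain ⟨m, hm, hmi⟩ := exists_isCycleMin_sameCycle π (foataHat π i)
  obtain ⟨j, rfl⟩ := (foataHat π).surjective m
  rcases lt_trichotomy j i with hj | rfl | hj
  · exact absurd (h j hj) (hm _ hmi).not_gt
  · exact hm
  · exact absurd hmi.symm (hm.lt_foataHat hj).2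

/-- At a boundary between cycles both sides fail: the word descends to a new minimum, and the last
letter of a cycle is not below its image. -/
theorem foataHat_lt_iff (π : Perm (Fin n)) {i j : Fin n} (h : (j : ℕ) = i + 1) :
    foataHat π i < foataHat π j ↔
      foataHat π i < π (foataHat π i) ∧ foataHat π j = π (foataHat π i) := by
  rcases foataHat_succ π h with h' | ⟨h₁, h₂⟩
  · simp [h']
  · have := (h₁.lt_foataHat (i := i) (by rw [Fin.lt_def]; lia)).1
    have := h₂.apply_le
    constructor
    · intro; order
    · rintro ⟨_, _⟩; order

theorem exists_succ_of_lt_apply (π : Perm (Fin n)) {i : Fin n}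
    (h : foataHat π i < π (foataHat π i)) :
    ∃ j : Fin n, (j : ℕ) = i + 1 ∧ foataHat π j = π (foataHat π i) := by
  by_cases hi : (i : ℕ) + 1 = n
  · exact absurd (isCycleMin_apply_foataHat_last π hi).apply_le h.not_ge
  · refine ⟨⟨i + 1, by lia⟩, rfl, ?_⟩
    rcases foataHat_succ π (i := i) (j := ⟨i + 1, by lia⟩) rfl with h' | ⟨-, h'⟩
    · exact h'
    · exact absurd h'.apply_le h.not_ge

theorem mem_ascents_foataHat (π : Perm (Fin n)) (i : Fin n) :
    i ∈ ascents (foataHat π) ↔ foataHat π i < π (foataHat π i) := by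
  simp only [ascents, Finset.mem_filter, Finset.mem_univ, true_and]
  constructor
  · rintro ⟨j, hj, h⟩
    exact ((foataHat_lt_iff π hj).1 h).1
  · intro h
    obtain ⟨j, hj, hj'⟩ := exists_succ_of_lt_apply π h
    exact ⟨j, hj, (foataHat_lt_iff π hj).2 ⟨h, hj'⟩⟩

theorem mem_occ123_foataHat (π : Perm (Fin n)) (i : Fin n) :
    i ∈ occ123 (foataHat π) ↔
      foataHat π i < π (foataHat π i) ∧ π (foataHat π i) < π (π (foataHat π i)) := by
  simp only [occ123, Finset.mem_filter, Finset.mem_univ, true_and]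
  constructor
  · rintro ⟨j, k, hj, hk, h₁, h₂⟩
    rw [foataHat_lt_iff π hj] at h₁
    rw [foataHat_lt_iff π (hk.trans (by rw [hj])), h₁.2] at h₂
    exact ⟨h₁.1, h₂.1⟩
  · rintro ⟨h₁, h₂⟩
    obtain ⟨j, hj, hj'⟩ := exists_succ_of_lt_apply π h₁
    rw [← hj'] at h₂
    obtain ⟨k, hk, hk'⟩ := exists_succ_of_lt_apply π h₂
    exact ⟨j, k, hj, by rw [hk, hj], (foataHat_lt_iff π hj).2 ⟨hj' ▸ h₁, hj'⟩,
      (foataHat_lt_iff π hk).2 ⟨h₂, hk'⟩⟩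

theorem excedance_iff_ascent (π : Perm (Fin n)) (a b : Fin n) :
    (a < b ∧ π a = b) ↔ ∃ i j : Fin n, i ∈ ascents (foataHat π) ∧
      (j : ℕ) = i + 1 ∧ foataHat π i = a ∧ foataHat π j = b := by
  constructor
  · rintro ⟨h, rfl⟩
    obtain ⟨i, rfl⟩ := (foataHat π).surjective a
    obtain ⟨j, hj, hj'⟩ := exists_succ_of_lt_apply π h
    exact ⟨i, j, (mem_ascents_foataHat π i).2 h, hj, rfl, hj'⟩
  · rintro ⟨i, j, hi, hj, rfl, rfl⟩
    rw [mem_ascents_foataHat] at hi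
    obtain ⟨j', hj', h⟩ := exists_succ_of_lt_apply π hi
    obtain rfl : j' = j := Fin.ext (hj'.trans hj.symm)
    exact ⟨h ▸ hi, h.symm⟩

theorem doubleExcedance_iff_occ123 (π : Perm (Fin n)) (a b c : Fin n) :
    (a < b ∧ b < c ∧ π a = b ∧ π b = c) ↔
      ∃ i j k : Fin n, i ∈ occ123 (foataHat π) ∧ (j : ℕ) = i + 1 ∧ (k : ℕ) = i + 2 ∧
        foataHat π i = a ∧ foataHat π j = b ∧ foataHat π k = c := by
  constructor
  · rintro ⟨h₁, h₂, rfl, rfl⟩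
    obtain ⟨i, rfl⟩ := (foataHat π).surjective a
    obtain ⟨j, hj, hj'⟩ := exists_succ_of_lt_apply π h₁
    obtain ⟨k, hk, hk'⟩ := exists_succ_of_lt_apply π (i := j) (by rwa [hj'])
    exact ⟨i, j, k, (mem_occ123_foataHat π i).2 ⟨h₁, h₂⟩, hj, by rw [hk, hj], rfl, hj',
      by rw [hk', hj']⟩
  · rintro ⟨i, j, k, hi, hj, hk, rfl, rfl, rfl⟩
    obtain ⟨h₁, h₂⟩ := (mem_occ123_foataHat π i).1 hi
    obtain ⟨j', hj', h⟩ := exists_succ_of_lt_apply π h₁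
    obtain rfl : j' = j := Fin.ext (hj'.trans hj.symm)
    rw [← h] at h₁ h₂
    obtain ⟨k', hk', h'⟩ := exists_succ_of_lt_apply π h₂
    obtain rfl : k' = k := Fin.ext (by lia)
    exact ⟨h₁, h' ▸ h₂, h.symm, h'.symm⟩

theorem card_filter_foataHat (π : Perm (Fin n)) (s : Finset (Fin n)) (p : Fin n → Prop)
    [DecidablePred p] (h : ∀ i, i ∈ s ↔ p (foataHat π i)) :
    s.card = (Finset.univ.filter p).card :=
  Finset.card_bij (fun i _ => foataHat π i) (fun i hi => by simpa using (h i).1 hi)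
    (fun i _ j _ hij => (foataHat π).injective hij) fun b hb => by
      obtain ⟨i, rfl⟩ := (foataHat π).surjective b
      exact ⟨i, (h i).2 (by simpa using hb), rfl⟩

theorem card_occ123_foataHat (π : Perm (Fin n)) :
    (occ123 (foataHat π)).card = (doubleExcedances π).card := by
  rw [doubleExcedances, Finset.card_image_of_injective _ π.injective]
  exact card_filter_foataHat π _ _ (mem_occ123_foataHat π)

theorem card_ascents_foataHat (π : Perm (Fin n)) :
    (ascents (foataHat π)).card = (excedances π).card := by
  rw [excedances, Finset.card_image_of_injective _ π.injective]
  exact card_filter_foataHat π _ _ (mem_ascents_foataHat π)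

theorem cycleCount_eq_card (π : Perm (Fin n)) :
    cycleCount π = (Finset.univ.filter (IsCycleMin π)).card := by
  rw [cycleCount, ← Fintype.card_coe, ← Nat.card_eq_fintype_card]
  refine (Nat.card_eq_of_bijective
    (fun m : Finset.univ.filter (IsCycleMin π) =>
      (Quotient.mk (Perm.SameCycle.setoid π) (m : Fin n))) ⟨?_, ?_⟩).symm
  · rintro ⟨a, ha⟩ ⟨b, hb⟩ h
    simp only [Finset.mem_filter, Finset.mem_univ, true_and] at ha hb
    exact Subtype.ext (ha.eq_of_sameCycle hb (Quotient.exact h))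
  · intro q
    induction q using Quotient.inductionOn with
    | h a =>
      obtain ⟨m, hm, h⟩ := exists_isCycleMin_sameCycle π a
      exact ⟨⟨m, by simpa using hm⟩, Quotient.sound h⟩

theorem card_lrMinima_foataHat (π : Perm (Fin n)) :
    (lrMinima (foataHat π)).card = cycleCount π := by
  rw [cycleCount_eq_card]
  exact card_filter_foataHat π _ _ (mem_lrMinima_foataHat π)

/-- Equal words have equal records, hence equal cycle minima. Each letter is then mapped either to
the next letter or back to the last record. -/
theorem foataHat_injective : Function.Injective (foataHat : Perm (Fin n) → Perm (Fin n)) := by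
  intro π σ h
  have hmin : ∀ a, IsCycleMin π a ↔ IsCycleMin σ a := by
    intro a
    obtain ⟨i, rfl⟩ := (foataHat π).surjective a
    rw [← mem_lrMinima_foataHat, h, mem_lrMinima_foataHat]
  have hnext : ∀ (π : Perm (Fin n)) (i j : Fin n), (j : ℕ) = i + 1 →
      ¬IsCycleMin π (foataHat π j) → π (foataHat π i) = foataHat π j :=
    fun π i j hj hm => ((foataHat_succ π hj).resolve_right fun h => hm h.1).symm
  -- Here `m` is the last record up to position `k`; it heads the cycle of the letter for both
  -- permutations.
  have hcommon : ∀ (k : ℕ) (hk : k < n), ∃ m, IsCycleMin π m ∧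
      π.SameCycle m (foataHat π ⟨k, hk⟩) ∧ σ.SameCycle m (foataHat π ⟨k, hk⟩) := by
    intro k
    induction k with
    | zero =>
      intro hk
      refine ⟨foataHat π ⟨0, hk⟩, ?_, Perm.SameCycle.refl _ _, Perm.SameCycle.refl _ _⟩
      rw [← mem_lrMinima_foataHat]
      exact Finset.mem_filter.2 ⟨Finset.mem_univ _, fun j hj => absurd hj (Nat.not_lt_zero _)⟩
    | succ k ih =>
      intro hk
      by_cases hm : IsCycleMin π (foataHat π ⟨k + 1, hk⟩)
      · exact ⟨_, hm, Perm.SameCycle.refl _ _, Perm.SameCycle.refl _ _⟩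
      · obtain ⟨m, h₀, h₁, h₂⟩ := ih (by lia)
        have e₁ := hnext π ⟨k, by lia⟩ ⟨k + 1, hk⟩ rfl hm
        have e₂ := hnext σ ⟨k, by lia⟩ ⟨k + 1, hk⟩ rfl (by rwa [← hmin, ← h])
        rw [← h] at e₂
        refine ⟨m, h₀, ?_, ?_⟩
        · rw [← e₁]; exact Perm.sameCycle_apply_right.2 h₁
        · rw [← e₂]; exact Perm.sameCycle_apply_right.2 h₂
  ext1 a
  obtain ⟨i, rfl⟩ := (foataHat π).surjective a
  obtain ⟨m, h₀, h₁, h₂⟩ := hcommon i i.2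
  by_cases hi : ∃ j : Fin n, (j : ℕ) = i + 1 ∧ ¬IsCycleMin π (foataHat π j)
  · obtain ⟨j, hj, hm⟩ := hi
    have e₂ := hnext σ i j hj (by rwa [← hmin, ← h])
    rw [← h] at e₂
    rw [hnext π i j hj hm, e₂]
  · push Not at hi
    have key : ∀ π : Perm (Fin n), (∀ j : Fin n, (j : ℕ) = i + 1 → IsCycleMin π (foataHat π j)) →
        IsCycleMin π (π (foataHat π i)) := by
      intro π hi
      by_cases hn : (i : ℕ) + 1 = n
      · exact isCycleMin_apply_foataHat_last π hn
      · have hj := hi ⟨i + 1, by lia⟩ rfl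
        rcases foataHat_succ π (i := i) (j := ⟨i + 1, by lia⟩) rfl with h' | h'
        · exact h' ▸ hj
        · exact h'.2
    have k₁ := key π hi
    have k₂ := key σ fun j hj => by rw [← h, ← hmin]; exact hi j hj
    rw [← h] at k₂
    rw [← h₀.eq_of_sameCycle k₁ (Perm.sameCycle_apply_right.2 h₁),
      ← ((hmin m).1 h₀).eq_of_sameCycle k₂ (Perm.sameCycle_apply_right.2 h₂)]

theorem foataHat_bijective : Function.Bijective (foataHat : Perm (Fin n) → Perm (Fin n)) :=
  Finite.injective_iff_bijective.1 foataHat_injective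

end PermStat

/-! ### From tridiagonal recurrences to J-fractions -/

namespace JFrac

open PowerSeries

variable {R : Type*} [CommRing R]

theorem mul_convergentFrom_succ (d l : ℕ → R) (h N : ℕ) :
    (1 - C (l h) * X - C (d (h + 1)) * X ^ 2 * convergentFrom d l (h + 1) N) *
      convergentFrom d l h (N + 1) = 1 := by
  rw [convergentFrom]
  exact mul_invOfUnit _ _ (by simp)

/-- If the series `G h` satisfy the system of a tridiagonal transfer matrix, with sources `S h`,
then the ratio `G h / S h` is approximated by the convergents from level `h`. -/
theorem X_pow_dvd_sub_convergentFrom_mul {d l a b : ℕ → R} {G S : ℕ → R⟦X⟧}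
    (hS : ∀ h, S (h + 1) = C (a h) * X * G h)
    (hG : ∀ h, G h = S h + C (l h) * X * G h + C (b h) * X * G (h + 1))
    (hd : ∀ h, d (h + 1) = a h * b h) (N h : ℕ) :
    X ^ N ∣ G h - convergentFrom d l h N * S h := by
  induction N generalizing h with
  | zero => simp
  | succ N ih =>
    obtain ⟨E, hE⟩ := ih (h + 1)
    have hc := mul_convergentFrom_succ d l h N
    rw [hS, sub_eq_iff_eq_add] at hE
    -- The error `X ^ N * E` at level `h + 1` enters level `h` through the factor `C (b h) * X`,
    -- which raises its order by one.
    refine ⟨convergentFrom d l h (N + 1) * C (b h) * E, ?_⟩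
    have hg := hG h
    rw [hE] at hg
    rw [hd, map_mul] at hc
    linear_combination (convergentFrom d l h (N + 1)) * hg - G h * hc

theorem isJFraction_of_recurrence {d l a b : ℕ → R} {p : ℕ → ℕ → R}
    (h00 : p 0 0 = 1) (h0 : ∀ h, p 0 (h + 1) = 0)
    (hz : ∀ m, p (m + 1) 0 = l 0 * p m 0 + b 0 * p m 1)
    (hs : ∀ m h, p (m + 1) (h + 1) =
      a h * p m h + l (h + 1) * p m (h + 1) + b (h + 1) * p m (h + 2))
    (hd : ∀ h, d (h + 1) = a h * b h) :
    IsJFraction (mk fun m => p m 0) d l := by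
  let G : ℕ → R⟦X⟧ := fun h => mk fun m => p m h
  -- The source at level `0` is `1`, so there the ratio `G 0 / S 0` is the series itself.
  let S : ℕ → R⟦X⟧ := fun h => Nat.casesOn h 1 fun k => C (a k) * X * G k
  have hG : ∀ h, G h = S h + C (l h) * X * G h + C (b h) * X * G (h + 1) := by
    intro h
    ext m
    cases h <;> cases m <;>
      simp [G, S, mul_assoc, coeff_succ_X_mul, h00, h0, hz, hs, coeff_one]
  intro m
  filter_upwards [Filter.eventually_gt_atTop m] with N hN
  have := X_pow_dvd_iff.1 (X_pow_dvd_sub_convergentFrom_mul (fun _ => rfl) hG hd N 0) m hN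
  rw [map_sub, sub_eq_zero] at this
  simpa [S, G] using this.symm

end JFrac

/-! ### Insertion of a new maximum into the cycles -/

namespace PermStat

open Equiv Polynomial

variable {n : ℕ}

/-- Insertion of a new largest element into the cycles of `τ`: as a fixed point (`none`), or just
before `x` in its cycle (`some x`). -/
def insertLast : Option (Fin n) × Perm (Fin n) ≃ Perm (Fin (n + 1)) :=
  Perm.decomposeOption.symm.trans (permCongr finSuccEquivLast.symm)

theorem insertLast_none_castSucc (τ : Perm (Fin n)) (i : Fin n) :
    insertLast (none, τ) i.castSucc = (τ i).castSucc := by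
  simp [insertLast, permCongr_apply]

theorem insertLast_none_last (τ : Perm (Fin n)) :
    insertLast (none, τ) (Fin.last n) = Fin.last n := by
  simp [insertLast, permCongr_apply]

theorem insertLast_some_castSucc (τ : Perm (Fin n)) (x i : Fin n) :
    insertLast (some x, τ) i.castSucc = if τ i = x then Fin.last n else (τ i).castSucc := by
  split_ifs with h
  · simp [insertLast, permCongr_apply, h]
  · have : swap none (some x) (some (τ i)) = some (τ i) :=
      swap_apply_of_ne_of_ne (by simp) (by simpa using h)
    simp [insertLast, permCongr_apply, this]

theorem insertLast_some_last (τ : Perm (Fin n)) (x : Fin n) :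
    insertLast (some x, τ) (Fin.last n) = x.castSucc := by
  simp [insertLast, permCongr_apply]

theorem insertLast_none_symm_castSucc (τ : Perm (Fin n)) (i : Fin n) :
    (insertLast (none, τ)).symm i.castSucc = (τ.symm i).castSucc := by
  rw [symm_apply_eq, insertLast_none_castSucc, apply_symm_apply]

theorem insertLast_none_symm_last (τ : Perm (Fin n)) :
    (insertLast (none, τ)).symm (Fin.last n) = Fin.last n := by
  rw [symm_apply_eq, insertLast_none_last]

theorem insertLast_some_symm_castSucc (τ : Perm (Fin n)) (x i : Fin n) :
    (insertLast (some x, τ)).symm i.castSucc =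
      if i = x then Fin.last n else (τ.symm i).castSucc := by
  rw [symm_apply_eq]
  split_ifs with h
  · rw [insertLast_some_last, h]
  · rw [insertLast_some_castSucc, apply_symm_apply, if_neg h]

theorem insertLast_some_symm_last (τ : Perm (Fin n)) (x : Fin n) :
    (insertLast (some x, τ)).symm (Fin.last n) = (τ.symm x).castSucc := by
  rw [symm_apply_eq, insertLast_some_castSucc, apply_symm_apply, if_pos rfl]

theorem SameCycle.map_of_forall {α β : Type*} [Finite α] {σ : Perm α} {τ : Perm β} (f : α → β)
    (hf : ∀ p, τ.SameCycle (f p) (f (σ p))) {p q : α} (h : σ.SameCycle p q) :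
    τ.SameCycle (f p) (f q) := by
  obtain ⟨k, -, rfl⟩ := h.exists_pow_eq'
  induction k with
  | zero => exact Perm.SameCycle.refl _ _
  | succ k ih =>
    rw [pow_succ', Perm.mul_apply]
    exact (ih ⟨k, by simp⟩).trans (hf _)

theorem sameCycle_insertLast (o : Option (Fin n)) (τ : Perm (Fin n)) (i j : Fin n) :
    (insertLast (o, τ)).SameCycle i.castSucc j.castSucc ↔ τ.SameCycle i j := by
  constructor
  · intro h
    -- The new element is contracted onto its image `x`; if it is a fixed point, `i` is an arbitrary
    -- value for it.
    have := SameCycle.map_of_forall (τ := τ)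
      (Fin.lastCases (motive := fun _ => Fin n) (o.getD i) id) ?_ h
    · simpa using this
    · intro p
      cases o with
      | none =>
        cases p using Fin.lastCases with
        | last => simp [insertLast_none_last, Perm.SameCycle.refl]
        | cast p => simp [insertLast_none_castSucc, Perm.SameCycle.refl]
      | some x =>
        cases p using Fin.lastCases with
        | last => simp [insertLast_some_last, Perm.SameCycle.refl]
        | cast p =>
          rw [insertLast_some_castSucc]
          split_ifs with hp
          · simp [← hp, Perm.SameCycle.refl]
          · simp [Perm.SameCycle.refl]
  · refine SameCycle.map_of_forall _ fun p => ?_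
    cases o with
    | none =>
      rw [← insertLast_none_castSucc, Perm.sameCycle_apply_right]
    | some x =>
      by_cases hp : τ p = x
      · have : (τ p).castSucc = insertLast (some x, τ) (insertLast (some x, τ) p.castSucc) := by
          rw [insertLast_some_castSucc, if_pos hp, insertLast_some_last, hp]
        rw [this, Perm.sameCycle_apply_right, Perm.sameCycle_apply_right]
      · have : (τ p).castSucc = insertLast (some x, τ) p.castSucc := by
          rw [insertLast_some_castSucc, if_neg hp]
        rw [this, Perm.sameCycle_apply_right]

theorem isCycleMin_insertLast_castSucc (o : Option (Fin n)) (τ : Perm (Fin n)) (i : Fin n) :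
    IsCycleMin (insertLast (o, τ)) i.castSucc ↔ IsCycleMin τ i := by
  constructor
  · intro h j hj
    exact h j.castSucc ((sameCycle_insertLast o τ i j).2 hj)
  · intro h j hj
    cases j using Fin.lastCases with
    | last => exact (Fin.castSucc_lt_last i).le
    | cast j => exact h j ((sameCycle_insertLast o τ i j).1 hj)

theorem isCycleMin_insertLast_last (o : Option (Fin n)) (τ : Perm (Fin n)) :
    IsCycleMin (insertLast (o, τ)) (Fin.last n) ↔ o = none := by
  cases o with
  | none =>
    simp only [iff_true]
    intro j hj
    exact (hj.eq_of_left (insertLast_none_last τ)).le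
  | some x =>
    simp only [reduceCtorEq, iff_false]
    intro h
    have := h _ (Perm.sameCycle_apply_right.2 (Perm.SameCycle.refl _ _))
    rw [insertLast_some_last] at this
    exact (Fin.castSucc_lt_last x).not_ge this

/-! ### Local weights and the differential recurrence -/

variable {R : Type*} [CommRing R]

theorem pow_cycleCount (t : R) (π : Perm (Fin n)) :
    t ^ cycleCount π = ∏ j, if IsCycleMin π j then t else 1 := by
  rw [cycleCount_eq_card, Finset.prod_ite]
  simp

theorem pow_cycleCount_insertLast (t : R) (o : Option (Fin n)) (τ : Perm (Fin n)) :
    t ^ cycleCount (insertLast (o, τ)) = t ^ cycleCount τ * if o = none then t else 1 := by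
  simp only [pow_cycleCount, Fin.prod_univ_castSucc, isCycleMin_insertLast_castSucc,
    isCycleMin_insertLast_last]

/-- The weight of a peak. -/
noncomputable def peakWeight (v w : R) : R[X] := C v + C (1 + v * w) * X + X ^ 2

open Classical in
/-- The weight of an element of a cycle, depending on whether it is an excedance value (`p`) and on
whether it is smaller than its image (`q`). -/
noncomputable def localWeight (v w : R) (p q : Prop) : R[X] :=
  if p then if q then C (v * w) + X else peakWeight v w else if q then 1 else 1 + X

/-- This rule determines the weights by integration from the valley weight `1`. The integration
constants, `v w` for double excedances, `v` for peaks and `1` otherwise, are the weights of the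
statistics. -/
theorem derivative_localWeight (v w : R) (p q : Prop) [Decidable p] [Decidable q] :
    derivative (localWeight v w p q) =
      (if p then localWeight v w False q else 0) + if q then 0 else localWeight v w p True := by
  by_cases hp : p <;> by_cases hq : q <;> simp [localWeight, peakWeight, hp, hq]
  ring

/-- The product of the local weights of the elements of a permutation. -/
noncomputable def weight (v w : R) (π : Perm (Fin n)) : R[X] :=
  ∏ j, localWeight v w (π.symm j < j) (j < π j)

theorem weight_insertLast_none (v w : R) (τ : Perm (Fin n)) :
    weight v w (insertLast (none, τ)) = weight v w τ * (1 + X) := by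
  simp only [weight, Fin.prod_univ_castSucc, insertLast_none_castSucc, insertLast_none_last,
    insertLast_none_symm_castSucc, insertLast_none_symm_last, Fin.castSucc_lt_castSucc_iff]
  simp [localWeight]

theorem weight_insertLast_some (v w : R) (τ : Perm (Fin n)) (x : Fin n) :
    weight v w (insertLast (some x, τ)) = peakWeight v w *
      ∏ j, localWeight v w (j ≠ x ∧ τ.symm j < j) (τ j = x ∨ j < τ j) := by
  simp only [weight, Fin.prod_univ_castSucc, insertLast_some_castSucc, insertLast_some_last,
    insertLast_some_symm_castSucc, insertLast_some_symm_last]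
  rw [mul_comm]
  congr 1
  · simp [localWeight, Fin.castSucc_lt_last, (Fin.castSucc_lt_last _).not_gt]
  · refine Finset.prod_congr rfl fun j _ => ?_
    congr 1
    · split_ifs with h <;> simp [h, Fin.le_last]
    · split_ifs with h <;> simp [h, Fin.castSucc_lt_last]

/-- The new maximum is a peak. The sum over its places matches the Leibniz rule: each term of the
derivative of a local weight corresponds to one place. -/
theorem sum_weight_insertLast_some (v w : R) (τ : Perm (Fin n)) :
    ∑ x, weight v w (insertLast (some x, τ)) = peakWeight v w * derivative (weight v w τ) := by
  -- Let `y = τ⁻¹ x`. If `y < x`, only `x` changes, ceasing to be an excedance value; otherwise only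
  -- `y` changes, becoming smaller than its image. The second test is phrased through `y`, so that
  -- this part can be reindexed by `y`.
  have hterm : ∀ x, weight v w (insertLast (some x, τ)) = peakWeight v w *
      ((if τ.symm x < x then (∏ j ∈ Finset.univ.erase x,
          localWeight v w (τ.symm j < j) (j < τ j)) * localWeight v w False (x < τ x) else 0) +
        if τ.symm x < τ (τ.symm x) then 0 else (∏ j ∈ Finset.univ.erase (τ.symm x),
          localWeight v w (τ.symm j < j) (j < τ j)) *
            localWeight v w (τ.symm (τ.symm x) < τ.symm x) True) := by
    intro x
    rw [weight_insertLast_some, apply_symm_apply]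
    congr 1
    split_ifs with h
    · rw [add_zero, ← Finset.prod_erase_mul _ _ (Finset.mem_univ x)]
      congr 1
      · refine Finset.prod_congr rfl fun j hj => ?_
        have hj := Finset.ne_of_mem_erase hj
        congr 1
        · simp [hj]
        · rw [eq_iff_iff, or_iff_right_iff_imp]
          rintro rfl
          simpa using h
      · congr 1
        · simp
        · rw [eq_iff_iff, or_iff_right_iff_imp]
          intro h'
          rw [← h', symm_apply_apply, h'] at h
          exact absurd h (lt_irrefl _)
    · rw [zero_add, ← Finset.prod_erase_mul _ _ (Finset.mem_univ (τ.symm x))]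
      congr 1
      · refine Finset.prod_congr rfl fun j hj => ?_
        have hj := Finset.ne_of_mem_erase hj
        congr 1
        · rw [eq_iff_iff, and_iff_right_iff_imp]
          rintro h' rfl
          exact h h'
        · rw [eq_iff_iff, or_iff_right_iff_imp]
          intro h'
          exact absurd ((symm_apply_eq τ).2 h'.symm).symm hj
      · congr 1
        · rw [eq_iff_iff, and_iff_right_iff_imp]
          intro h' h''
          rw [h'', h''] at h'
          exact lt_irrefl _ h'
        · simp
  rw [Finset.sum_congr rfl fun x _ => hterm x, ← Finset.mul_sum, Finset.sum_add_distrib]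
  congr 1
  rw [τ.symm.sum_comp fun a => if a < τ a then (0 : R[X]) else (∏ j ∈ Finset.univ.erase a,
          localWeight v w (τ.symm j < j) (j < τ j)) * localWeight v w (τ.symm a < a) True,
    ← Finset.sum_add_distrib, weight, derivative_prod_finset]
  refine Finset.sum_congr rfl fun x _ => ?_
  rw [derivative_localWeight]
  split_ifs <;> ring

/-- The generating polynomial of permutations of `Fin n` by local weights and cycles. -/
noncomputable def cyclePoly (v w t : R) (n : ℕ) : R[X] :=
  ∑ π : Perm (Fin n), C (t ^ cycleCount π) * weight v w π

theorem cyclePoly_zero (v w t : R) : cyclePoly v w t 0 = 1 := by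
  simp [cyclePoly, weight, cycleCount_eq_card]

theorem cyclePoly_succ (v w t : R) (n : ℕ) :
    cyclePoly v w t (n + 1) = C t * (1 + X) * cyclePoly v w t n +
      peakWeight v w * derivative (cyclePoly v w t n) := by
  rw [cyclePoly, ← insertLast.sum_comp, Fintype.sum_prod_type, Fintype.sum_option]
  congr 1
  · rw [cyclePoly, Finset.mul_sum]
    refine Finset.sum_congr rfl fun τ _ => ?_
    rw [pow_cycleCount_insertLast, weight_insertLast_none, if_pos rfl, map_mul]
    ring
  · rw [Finset.sum_comm, cyclePoly, derivative_sum, Finset.mul_sum]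
    refine Finset.sum_congr rfl fun τ _ => ?_
    simp only [pow_cycleCount_insertLast, reduceCtorEq, if_false, mul_one]
    rw [← Finset.mul_sum, sum_weight_insertLast_some, derivative_C_mul]
    ring

/-! ### Coefficient recurrences and the generating functions -/

theorem coeff_zero_cyclePoly_succ (v w t : R) (n : ℕ) :
    (cyclePoly v w t (n + 1)).coeff 0 =
      t * (cyclePoly v w t n).coeff 0 + v * (cyclePoly v w t n).coeff 1 := by
  rw [cyclePoly_succ]
  simp [mul_coeff_zero, coeff_derivative, peakWeight]

theorem coeff_succ_cyclePoly_succ (v w t : R) (n h : ℕ) :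
    (cyclePoly v w t (n + 1)).coeff (h + 1) =
      (h + t) * (cyclePoly v w t n).coeff h +
        (t + (h + 1) * (1 + v * w)) * (cyclePoly v w t n).coeff (h + 1) +
        v * (h + 2) * (cyclePoly v w t n).coeff (h + 2) := by
  have e : cyclePoly v w t (n + 1) = C t * cyclePoly v w t n + C t * (X * cyclePoly v w t n) +
      C v * derivative (cyclePoly v w t n) +
      C (1 + v * w) * (X * derivative (cyclePoly v w t n)) +
      X * (X * derivative (cyclePoly v w t n)) := by
    rw [cyclePoly_succ, peakWeight]; ring
  rw [e]
  simp only [coeff_add, coeff_C_mul, coeff_X_mul, coeff_derivative]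
  cases h with
  | zero => simp; ring
  | succ h => simp only [coeff_X_mul, coeff_derivative]; push_cast; ring

theorem coeff_zero_weight (v w : R) (π : Perm (Fin n)) :
    (weight v w π).coeff 0 = v ^ (excedances π).card * w ^ (doubleExcedances π).card := by
  have h₁ : excedances π = Finset.univ.filter fun j => π.symm j < j := by
    ext j
    simp only [excedances, Finset.mem_image, Finset.mem_filter, Finset.mem_univ, true_and]
    exact ⟨by rintro ⟨i, hi, rfl⟩; simpa using hi, fun h => ⟨π.symm j, by simpa using h, by simp⟩⟩
  have h₂ : doubleExcedances π = Finset.univ.filter fun j => π.symm j < j ∧ j < π j := by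
    ext j
    simp only [doubleExcedances, Finset.mem_image, Finset.mem_filter, Finset.mem_univ, true_and]
    exact ⟨by rintro ⟨i, hi, rfl⟩; simpa using hi, fun h => ⟨π.symm j, by simpa using h, by simp⟩⟩
  rw [h₁, h₂, weight, coeff_zero_prod, ← Finset.prod_const, ← Finset.prod_const,
    Finset.prod_filter, Finset.prod_filter, ← Finset.prod_mul_distrib]
  refine Finset.prod_congr rfl fun j _ => ?_
  by_cases hp : π.symm j < j <;> by_cases hq : j < π j <;>
    simp [localWeight, peakWeight, hp, hq]

theorem coeff_zero_cyclePoly (v w t : R) (n : ℕ) :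
    (cyclePoly v w t n).coeff 0 = ∑ π : Perm (Fin n),
      v ^ (ascents π).card * w ^ (occ123 π).card * t ^ (lrMinima π).card := by
  -- Reindexing by `π ↦ π̂` turns linear statistics into cycle statistics.
  rw [← (Equiv.ofBijective _ (foataHat_bijective (n := n))).sum_comp]
  simp only [ofBijective_apply, card_ascents_foataHat, card_occ123_foataHat,
    card_lrMinima_foataHat, cyclePoly, finsetSum_coeff, coeff_C_mul, coeff_zero_weight]
  exact Finset.sum_congr rfl fun π _ => mul_comm _ _

theorem isJFraction_ascents_occ123_lrMinima (v w t : R) :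
    JFrac.IsJFraction
      (PowerSeries.mk fun n => ∑ π : Perm (Fin n),
        v ^ (ascents π).card * w ^ (occ123 π).card * t ^ (lrMinima π).card)
      (fun h => v * (h : R) * ((h : R) - 1 + t)) (fun h => t + (h : R) * (1 + v * w)) := by
  simp only [← coeff_zero_cyclePoly]
  refine JFrac.isJFraction_of_recurrence (p := fun m h => (cyclePoly v w t m).coeff h)
    (a := fun h => h + t) (b := fun h => v * (h + 1)) ?_ ?_ ?_ ?_ ?_
  · simp [cyclePoly_zero]
  · simp [cyclePoly_zero, coeff_one]
  · intro m
    simp [coeff_zero_cyclePoly_succ]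
  · intro m h
    rw [coeff_succ_cyclePoly_succ]
    push_cast
    ring
  · intro h
    push_cast
    ring

end PermStat

theorem mainTheorem4 {R : Type*} [CommRing R] (v w t : R) :
    -- the generating function by occurrences of consecutive 123
    JFrac.IsJFraction
      (PowerSeries.mk fun n => ∑ π : Equiv.Perm (Fin n), w ^ (PermStat.occ123 π).card)
      (fun h => (h : R) ^ 2) (fun h => ((h : R) + 1) + (h : R) * w) ∧
    -- its refinement by ascents and left-to-right minima
    JFrac.IsJFraction
      (PowerSeries.mk fun n => ∑ π : Equiv.Perm (Fin n),
        v ^ (PermStat.ascents π).card * w ^ (PermStat.occ123 π).card *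
          t ^ (PermStat.lrMinima π).card)
      (fun h => v * (h : R) * ((h : R) - 1 + t)) (fun h => t + (h : R) * (1 + v * w)) ∧
    -- the map `π ↦ π̂` is a bijection
    (∀ n : ℕ, Function.Bijective (PermStat.foataHat : Equiv.Perm (Fin n) → Equiv.Perm (Fin n))) ∧
    ∀ (n : ℕ) (π : Equiv.Perm (Fin n)),
      -- it sends double excedances to occurrences of consecutive 123 ...
      (∀ a b c : Fin n,
        (a < b ∧ b < c ∧ π a = b ∧ π b = c) ↔
          ∃ i j k : Fin n, i ∈ PermStat.occ123 (PermStat.foataHat π) ∧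
            (j : ℕ) = i + 1 ∧ (k : ℕ) = i + 2 ∧ PermStat.foataHat π i = a ∧
            PermStat.foataHat π j = b ∧ PermStat.foataHat π k = c) ∧
      (PermStat.occ123 (PermStat.foataHat π)).card = (PermStat.doubleExcedances π).card ∧
      -- ... excedances to ascents ...
      (∀ a b : Fin n,
        (a < b ∧ π a = b) ↔
          ∃ i j : Fin n, i ∈ PermStat.ascents (PermStat.foataHat π) ∧
            (j : ℕ) = i + 1 ∧ PermStat.foataHat π i = a ∧ PermStat.foataHat π j = b) ∧
      (PermStat.ascents (PermStat.foataHat π)).card = (PermStat.excedances π).card ∧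
      -- ... and cycles, through their smallest elements, to left-to-right minima
      (∀ i : Fin n, i ∈ PermStat.lrMinima (PermStat.foataHat π) ↔
        PermStat.IsCycleMin π (PermStat.foataHat π i)) ∧
      (PermStat.lrMinima (PermStat.foataHat π)).card = PermStat.cycleCount π := by
  refine ⟨?_, PermStat.isJFraction_ascents_occ123_lrMinima v w t,
    fun n => PermStat.foataHat_bijective, fun n π =>
      ⟨PermStat.doubleExcedance_iff_occ123 π, PermStat.card_occ123_foataHat π,
        PermStat.excedance_iff_ascent π, PermStat.card_ascents_foataHat π,
        PermStat.mem_lrMinima_foataHat π, PermStat.card_lrMinima_foataHat π⟩⟩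
  -- The first series is the case `v = t = 1`, where `h (h - 1 + 1) = h²`.
  convert PermStat.isJFraction_ascents_occ123_lrMinima 1 w 1 using 1
  · simp
  · ext h; ring
  · ext h; ring
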